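/- Let $m, n \geq 1$ be integers with $m > n$, and let $\mathrm{S}(m,n) = \mathrm{Sgp}\langle x, y \mid yx^m = x^n y\rangle$ be the Baumslag–Solitar semigroup. Then every finitely generated subsemigroup of $\mathrm{S}(m,n)$ is (right-)automatic. Here a semigroup $S$ is right-automatic if there are a finite alphabet $A$ representing a set of generators of $S$ and a regular language $L \subseteq A^+$ such that every element of $S$ is represented by a word of $L$ and, for each $a \in A \cup \{\varepsilon\}$ ($\varepsilon$ the empty word), the language $$L_a = \{\delta_A(u,v) : u, v \in L,\ \overline{ua} = \overline{v}\}$$ is regular, where $\overline{w}$ is the element of $S$ represented by $w$ and $\delta_A(u,v)$ is the word over $\left((A\cup\{\$\})\times(A\cup\{\$\})\right) \setminus \{(\$,\$)\}$ obtained by reading $u$ and $v$ in parallel from the left after padding the shorter one on the right with the new symbol $\$$. -/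

import Mathlib

/-! ### Words -/

/-- The list of letters of a nonempty word; `FreeSemigroup A` is the set `A⁺` of nonempty words
over the alphabet `A`. -/
def FreeSemigroup.letters {A : Type*} (w : FreeSemigroup A) : List A :=
  w.head :: w.tail

/-! ### Baumslag–Solitar semigroups -/

/-- The two generators of a Baumslag–Solitar semigroup. -/
inductive BSGen : Type
  | x : BSGen
  | y : BSGen

/-- The single defining relation `y x ^ m = x ^ n y`, as a relation between nonempty words. -/
def BSRel (m n : ℕ) (u v : FreeSemigroup BSGen) : Prop :=
  u.letters = BSGen.y :: List.replicate m BSGen.x ∧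
    v.letters = List.replicate n BSGen.x ++ [BSGen.y]

/-- The Baumslag–Solitar semigroup `S(m, n) = Sgp⟨x, y | y x ^ m = x ^ n y⟩`: the quotient of the
free semigroup on `x, y` by the least congruence containing the defining relation. -/
def BSSemigroup (m n : ℕ) : Type :=
  (conGen (BSRel m n)).Quotient

instance BSSemigroup.instSemigroup (m n : ℕ) : Semigroup (BSSemigroup m n) :=
  inferInstanceAs (Semigroup (conGen (BSRel m n)).Quotient)

/-! ### Automatic semigroups -/

/-- The alphabet `A(2,$)` of pairs of letters from `A ∪ {$}` other than `($,$)`. The padding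
symbol `$` is `none`. -/
abbrev PaddedPair (A : Type*) : Type _ :=
  { p : Option A × Option A // p ≠ (none, none) }

/-- The padded word over `A(2,$)` of a pair of words: the two words are read in parallel from the
left, and the shorter one is padded on the right with `$`. -/
def paddedWord {A : Type*} : List A → List A → List (PaddedPair A)
  | [], v => v.map fun b => ⟨(none, some b), by simp⟩
  | a :: u, [] => (a :: u).map fun c => ⟨(some c, none), by simp⟩
  | a :: u, b :: v => ⟨(some a, some b), by simp⟩ :: paddedWord u v

/-- The language over `A` formed by a set of nonempty words. -/
def wordLanguage {A : Type*} (L : Set (FreeSemigroup A)) : Language A :=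
  FreeSemigroup.letters '' L

/-- The language `R δ_A` over `A(2,$)` of a relation `R` between nonempty words. -/
def paddedLanguage {A : Type*} (R : Set (FreeSemigroup A × FreeSemigroup A)) :
    Language (PaddedPair A) :=
  (fun p => paddedWord p.1.letters p.2.letters) '' R

/-- `(A, L)` is a right-automatic structure for the semigroup `S`, where each letter `a` of the
alphabet `A` represents the element `φ a` of `S`. A nonempty word `w` represents
`FreeSemigroup.lift φ w`. -/
structure IsRightAutomaticStructure {S : Type*} [Semigroup S] {A : Type*} (φ : A → S)
    (L : Set (FreeSemigroup A)) : Prop where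
  finite_alphabet : Finite A
  generates : Subsemigroup.closure (Set.range φ) = ⊤
  regular : (wordLanguage L).IsRegular
  surjective : FreeSemigroup.lift φ '' L = Set.univ
  regular_eq : (paddedLanguage
    {p | p.1 ∈ L ∧ p.2 ∈ L ∧
      FreeSemigroup.lift φ p.1 = FreeSemigroup.lift φ p.2}).IsRegular
  regular_mul : ∀ a : A, (paddedLanguage
    {p | p.1 ∈ L ∧ p.2 ∈ L ∧
      FreeSemigroup.lift φ (p.1 * FreeSemigroup.of a) = FreeSemigroup.lift φ p.2}).IsRegular

/-- A semigroup is right-automatic if it admits a right-automatic structure. (The alphabet is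
finite, so that it may be taken in the lowest universe.) -/
def IsRightAutomatic (S : Type*) [Semigroup S] : Prop :=
  ∃ (A : Type) (φ : A → S) (L : Set (FreeSemigroup A)), IsRightAutomaticStructure φ L

/-! ### Regular languages through left contexts -/

/-! Moving powers of `x` leftwards gives each element a normal form `x ^ c y x ^ b₁ y x ^ b₂ ⋯` with
all `bᵢ < m`. Left multiplication acts on the pairs `(c, [b₁, b₂, …])` like a transducer: the new
number and the pushed digits depend on `c` alone, and an element is determined by its effect on `(0,
[])` (`act_injective`). So `ua = v` in the semigroup says that `u`, started from `a · (0, [])`, and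
`v`, started from `(0, [])`, reach the same pair.

Such coincidences are checked by a finite automaton reading the padded word from the right. Two
bounds make its state finite. First, `n < m` makes every element containing `y` contract large
numbers (`exists_fst_act_le`), so the numbers stay bounded. Second, neighbouring letters are
multiplied together until each prefix pushes about `K` digits per letter (`exists_synchronized`).
The digit lists of the two tracks then differ only above a common tail, by a bounded amount, and
this tail is never read again (`exists_common_digits`, `isRegular_coincidenceLanguage`).

The obstruction is the powers of `x` in the subsemigroup, which push no digit and do not contract.
If there are any, fix one, `x ^ e`. All but a bounded part of such a power can be moved to the far
left as a power of `x ^ e` (`act_add_mul_pow`, `isShiftedProduct_act`), so words take the form `a ^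
j` followed by a synchronized word. Common powers of `a` cancel
(`coincidenceLanguage_prependPowers`), and what remains has bounded numbers. -/

theorem Set.finite_range_of_rel {X Y Q : Type*} (f : X → Set Y) {S : Set Q} (hS : S.Finite)
    (r : X → Q → Prop) (h₁ : ∀ x y, y ∈ f x → ∃ q ∈ S, r x q)
    (h₂ : ∀ x x' q, r x q → r x' q → f x ⊆ f x') : (Set.range f).Finite := by
  -- A nonempty `f x` is recovered from any state `q` related to `x`, as the union of the `f x'`
  -- over all `x'` related to `q`; the empty value is added by hand.
  refine ((hS.image fun q => {y | ∃ x, r x q ∧ y ∈ f x}).insert ∅).subset ?_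
  rintro _ ⟨x, rfl⟩
  rcases (f x).eq_empty_or_nonempty with h | ⟨y, hy⟩
  · exact Or.inl h
  · obtain ⟨q, hq, hr⟩ := h₁ x y hy
    refine Or.inr ⟨q, hq, ?_⟩
    ext y'
    exact ⟨fun ⟨x', hx', hy'⟩ => h₂ _ _ _ hx' hr hy', fun h => ⟨x, hr, h⟩⟩

namespace Language

variable {α : Type*}

/-- The set of words `p` such that `p ++ z` belongs to `L`. -/
def leftContext (L : Language α) (z : List α) : Set (List α) := {p | p ++ z ∈ L}

theorem mem_leftContext {L : Language α} {p z : List α} : p ∈ L.leftContext z ↔ p ++ z ∈ L :=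
  Iff.rfl

/-- Myhill–Nerode for the reversed language. Words act by `foldr`, so a suffix is the part whose
effect is already known. -/
theorem isRegular_iff_finite_range_leftContext {L : Language α} :
    L.IsRegular ↔ (Set.range L.leftContext).Finite := by
  have key : ∀ x, L.reverse.leftQuotient x = List.reverse ⁻¹' (L.leftContext x.reverse) := by
    intro x
    ext y
    change x ++ y ∈ L.reverse ↔ y.reverse ++ x.reverse ∈ L
    rw [Language.mem_reverse, List.reverse_append]
  rw [← isRegular_reverse_iff, isRegular_iff_finite_range_leftQuotient]
  have hinv : Function.Involutive (List.reverse : List α → List α) := List.reverse_reverse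
  have : Set.range L.reverse.leftQuotient
      = (fun s : Set (List α) => List.reverse ⁻¹' s) '' Set.range L.leftContext := by
    ext s
    constructor
    · rintro ⟨x, rfl⟩
      exact ⟨_, ⟨x.reverse, rfl⟩, (key x).symm⟩
    · rintro ⟨_, ⟨x, rfl⟩, rfl⟩
      refine ⟨x.reverse, ?_⟩
      rw [key, List.reverse_reverse]
  rw [this]
  exact Set.finite_image_iff (hinv.surjective.preimage_injective.injOn)

/-- The words of `L` preceded by some power of the letter `e`. -/
def prependPowers (e : α) (L : Language α) : Language α :=
  {u | ∃ j, ∃ v ∈ L, u = List.replicate j e ++ v}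

/-- If the cut falls inside the leading power, the left half is a power of `e` and it only matters
whether `z` lies in the new language; otherwise the left half ends in a left context of `z` for `L`.
-/
theorem IsRegular.prependPowers {L : Language α} (hL : L.IsRegular) (e : α) :
    (L.prependPowers e).IsRegular := by
  rw [isRegular_iff_finite_range_leftContext] at hL ⊢
  refine Set.finite_range_of_rel _ (hL.prod (Set.finite_univ (α := Prop)))
    (fun z q => q = (L.leftContext z, z ∈ L.prependPowers e)) (fun x y _ => ?_) ?_
  · exact ⟨_, ⟨⟨x, rfl⟩, trivial⟩, rfl⟩
  · rintro z z' q rfl h p ⟨j, v, hv, hpv⟩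
    simp only [Prod.mk.injEq, eq_iff_iff] at h
    rcases List.append_eq_append_iff.1 hpv with ⟨a, h1, h2⟩ | ⟨a, h1, h2⟩
    · have hz : z ∈ L.prependPowers e :=
        ⟨a.length, v, hv, by
          rw [h2, List.eq_replicate_of_mem (a := e) (l := a)]
          · simp
          · intro b hb
            refine List.eq_of_mem_replicate (n := j) ?_
            rw [h1]
            exact List.mem_append_right _ hb⟩
      obtain ⟨k, w, hw, rfl⟩ := h.2.1 hz
      refine ⟨p.length + k, w, hw, ?_⟩
      rw [List.replicate_add, List.append_assoc]
      congr 1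
      rw [List.eq_replicate_of_mem (a := e) (l := p)]
      · simp
      · intro b hb
        refine List.eq_of_mem_replicate (n := j) ?_
        rw [h1]
        exact List.mem_append_left _ hb
    · have ha : a ∈ L.leftContext z := by
        rw [mem_leftContext, ← h2]; exact hv
      rw [h.1] at ha
      exact ⟨j, a ++ z', ha, by rw [h1, List.append_assoc]⟩

end Language

/-! ### Padded words -/

section Padding

variable {A : Type*}

/-- The first track of a word over the padded alphabet, without padding symbols. -/
def firstTrack (z : List (PaddedPair A)) : List A := z.filterMap fun p => p.1.1

/-- The second track of a word over the padded alphabet, without padding symbols. -/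
def secondTrack (z : List (PaddedPair A)) : List A := z.filterMap fun p => p.1.2

theorem firstTrack_append (y z : List (PaddedPair A)) :
    firstTrack (y ++ z) = firstTrack y ++ firstTrack z := List.filterMap_append

theorem secondTrack_append (y z : List (PaddedPair A)) :
    secondTrack (y ++ z) = secondTrack y ++ secondTrack z := List.filterMap_append

theorem paddedWord_nil_left (v : List A) :
    paddedWord [] v = v.map fun b => ⟨(none, some b), by simp⟩ := by simp [paddedWord]

theorem paddedWord_nil_right (u : List A) :
    paddedWord u [] = u.map fun b => ⟨(some b, none), by simp⟩ := by
  cases u <;> simp [paddedWord]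

theorem paddedWord_cons_cons (a b : A) (u v : List A) :
    paddedWord (a :: u) (b :: v) = ⟨(some a, some b), by simp⟩ :: paddedWord u v := by
  rw [paddedWord]

theorem firstTrack_take_paddedWord (u v : List A) (i : ℕ) :
    firstTrack ((paddedWord u v).take i) = u.take i := by
  induction u generalizing v i with
  | nil =>
    rw [paddedWord_nil_left, ← List.map_take, firstTrack, List.filterMap_map]
    simp
  | cons a u ih =>
    cases v with
    | nil =>
      rw [paddedWord_nil_right, ← List.map_take, firstTrack, List.filterMap_map]
      simp
    | cons b v =>
      cases i with
      | zero => simp [firstTrack]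
      | succ i =>
        rw [paddedWord_cons_cons, List.take_succ_cons, List.take_succ_cons, ← ih v i]
        simp [firstTrack]

theorem secondTrack_take_paddedWord (u v : List A) (i : ℕ) :
    secondTrack ((paddedWord u v).take i) = v.take i := by
  induction u generalizing v i with
  | nil =>
    rw [paddedWord_nil_left, ← List.map_take, secondTrack, List.filterMap_map]
    simp
  | cons a u ih =>
    cases v with
    | nil =>
      rw [paddedWord_nil_right, ← List.map_take, secondTrack, List.filterMap_map]
      simp
    | cons b v =>
      cases i with
      | zero => simp [secondTrack]
      | succ i =>
        rw [paddedWord_cons_cons, List.take_succ_cons, List.take_succ_cons, ← ih v i]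
        simp [secondTrack]

theorem firstTrack_paddedWord (u v : List A) : firstTrack (paddedWord u v) = u := by
  have := firstTrack_take_paddedWord u v ((paddedWord u v).length + u.length)
  rwa [List.take_of_length_le (by omega), List.take_of_length_le (by omega)] at this

theorem secondTrack_paddedWord (u v : List A) : secondTrack (paddedWord u v) = v := by
  have := secondTrack_take_paddedWord u v ((paddedWord u v).length + v.length)
  rwa [List.take_of_length_le (by omega), List.take_of_length_le (by omega)] at this

/-- On each track, a padding symbol is followed by a padding symbol. -/
def PaddingPersists (p q : PaddedPair A) : Prop :=
  (p.1.1 = none → q.1.1 = none) ∧ (p.1.2 = none → q.1.2 = none)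

theorem isChain_paddedWord (u v : List A) : (paddedWord u v).IsChain PaddingPersists := by
  induction u generalizing v with
  | nil =>
    rw [paddedWord_nil_left, List.isChain_map]
    exact (List.isChain_iff_getElem.2 fun i hi => by simp [PaddingPersists])
  | cons a u ih =>
    cases v with
    | nil =>
      rw [paddedWord_nil_right, List.isChain_map]
      exact (List.isChain_iff_getElem.2 fun i hi => by simp [PaddingPersists])
    | cons b v =>
      rw [paddedWord_cons_cons, List.isChain_cons]
      exact ⟨fun _ _ => by simp [PaddingPersists], ih v⟩

/-- Being a padded word is thus a condition on adjacent letters, so replacing a right half by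
another with the same first letter preserves it. -/
theorem paddedWord_tracks {z : List (PaddedPair A)} (hz : z.IsChain PaddingPersists) :
    paddedWord (firstTrack z) (secondTrack z) = z := by
  induction z with
  | nil => simp [firstTrack, secondTrack, paddedWord]
  | cons p z ih =>
    obtain ⟨hp, hz'⟩ := List.isChain_cons.1 hz
    have ih := ih hz'
    obtain ⟨⟨a, b⟩, hab⟩ := p
    cases a with
    | none =>
      cases b with
      | none => exact absurd rfl hab
      | some b =>
        -- A letter on the first track of `z` would, by `ih`, put a letter in the first place of
        -- that track, against the persistence of padding.
        have h0 : firstTrack z = [] := by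
          cases hft : firstTrack z with
          | nil => rfl
          | cons c l =>
            exfalso
            cases z with
            | nil => simp [firstTrack] at hft
            | cons q z =>
              have hq : q.1.1 = none := (hp q rfl).1 rfl
              rw [hft] at ih
              cases hs : secondTrack (q :: z) with
              | nil =>
                rw [hs, paddedWord_nil_right] at ih
                simp only [List.map_cons, List.cons.injEq] at ih
                rw [← ih.1] at hq
                simp at hq
              | cons d l' =>
                rw [hs, paddedWord_cons_cons] at ih
                simp only [List.cons.injEq] at ih
                rw [← ih.1] at hq
                simp at hq
        rw [h0, paddedWord_nil_left] at ih
        have h1 : firstTrack (⟨(none, some b), hab⟩ :: z) = [] := by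
          rw [← h0]; simp [firstTrack]
        have h2 : secondTrack (⟨(none, some b), hab⟩ :: z) = b :: secondTrack z := by
          simp [secondTrack]
        rw [h1, h2, paddedWord_nil_left, List.map_cons, ih]
    | some a =>
      cases b with
      | none =>
        have h0 : secondTrack z = [] := by
          cases hft : secondTrack z with
          | nil => rfl
          | cons c l =>
            exfalso
            cases z with
            | nil => simp [secondTrack] at hft
            | cons q z =>
              have hq : q.1.2 = none := (hp q rfl).2 rfl
              rw [hft] at ih
              cases hs : firstTrack (q :: z) with
              | nil =>
                rw [hs, paddedWord_nil_left] at ih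
                simp only [List.map_cons, List.cons.injEq] at ih
                rw [← ih.1] at hq
                simp at hq
              | cons d l' =>
                rw [hs, paddedWord_cons_cons] at ih
                simp only [List.cons.injEq] at ih
                rw [← ih.1] at hq
                simp at hq
        rw [h0, paddedWord_nil_right] at ih
        have h1 : secondTrack (⟨(some a, none), hab⟩ :: z) = [] := by
          rw [← h0]; simp [secondTrack]
        have h2 : firstTrack (⟨(some a, none), hab⟩ :: z) = a :: firstTrack z := by
          simp [firstTrack]
        rw [h1, h2, paddedWord_nil_right, List.map_cons, ih]
      | some b =>
        have h1 : firstTrack (⟨(some a, some b), hab⟩ :: z) = a :: firstTrack z := by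
          simp [firstTrack]
        have h2 : secondTrack (⟨(some a, some b), hab⟩ :: z) = b :: secondTrack z := by
          simp [secondTrack]
        rw [h1, h2, paddedWord_cons_cons, ih]

theorem paddedWord_replicate_append (i : ℕ) (e : A) (u v : List A) :
    paddedWord (List.replicate i e ++ u) (List.replicate i e ++ v) =
      List.replicate i ⟨(some e, some e), by simp⟩ ++ paddedWord u v := by
  induction i with
  | zero => simp
  | succ i ih => simp [List.replicate_succ, paddedWord_cons_cons, ih]

end Padding

/-! ### Transformations that push digits -/

/-- A transformation of pairs of a number and a list of digits which pushes `k` digits: the new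
number and the pushed digits depend on the number alone. -/
def PushesDigits {β : Type*} (k : ℕ) (f : ℕ × List β → ℕ × List β) : Prop :=
  (∀ c l, f (c, l) = ((f (c, [])).1, (f (c, [])).2 ++ l)) ∧ ∀ c, (f (c, [])).2.length = k

namespace PushesDigits

variable {β : Type*} {k k' : ℕ} {f f' : ℕ × List β → ℕ × List β}

protected theorem id : PushesDigits 0 (id : ℕ × List β → ℕ × List β) := by
  simp [PushesDigits]

theorem comp (hf : PushesDigits k f) (hf' : PushesDigits k' f') :
    PushesDigits (k + k') (f ∘ f') := by
  refine ⟨fun c l => ?_, fun c => ?_⟩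
  · simp only [Function.comp]
    rw [hf'.1, hf.1, hf.1 (f' (c, [])).1 (f' (c, [])).2]
    simp
  · simp only [Function.comp]
    rw [← Prod.mk.eta (p := f' (c, [])), hf.1]
    simp [hf.2, hf'.2]

theorem length_snd (hf : PushesDigits k f) (g : ℕ × List β) :
    (f g).2.length = k + g.2.length := by
  rw [← Prod.mk.eta (p := g), hf.1]
  simp [hf.2]

theorem exists_snd_eq (hf : PushesDigits k f) (g : ℕ × List β) :
    ∃ d : List β, d.length = k ∧ (f g).2 = d ++ g.2 :=
  ⟨(f (g.1, [])).2, hf.2 _, by rw [← Prod.mk.eta (p := g), hf.1]⟩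

/-- Digits already pushed are never read, so a common tail of any length can be forgotten. -/
theorem eq_append_iff (hf : PushesDigits k f) (hf' : PushesDigits k' f') (c c' : ℕ)
    (d d' l : List β) : f (c, d ++ l) = f' (c', d' ++ l) ↔ f (c, d) = f' (c', d') := by
  rw [hf.1 c, hf'.1 c', hf.1 c d, hf'.1 c' d']
  simp only [Prod.mk.injEq, ← List.append_assoc, List.append_left_inj]

end PushesDigits

/-! ### Words acting on pairs of a number and a list of digits -/

section Action

variable {A β : Type*} {act : A → ℕ × List β → ℕ × List β} {Y : A → ℕ}

/-- The number of digits pushed by a word whose letters push `Y` digits. -/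
def digitCount (Y : A → ℕ) (u : List A) : ℕ := (u.map Y).sum

@[simp]
theorem digitCount_nil (Y : A → ℕ) : digitCount Y [] = 0 := rfl

@[simp]
theorem digitCount_cons (Y : A → ℕ) (a : A) (u : List A) :
    digitCount Y (a :: u) = Y a + digitCount Y u := by simp [digitCount]

@[simp]
theorem digitCount_append (Y : A → ℕ) (u v : List A) :
    digitCount Y (u ++ v) = digitCount Y u + digitCount Y v := by simp [digitCount]

theorem pushesDigits_foldr (hact : ∀ a, PushesDigits (Y a) (act a)) (u : List A) :
    PushesDigits (digitCount Y u) (fun g => u.foldr act g) := by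
  induction u with
  | nil => exact PushesDigits.id
  | cons a u ih =>
    rw [digitCount_cons]
    exact (hact a).comp ih

theorem prefix_append_cases {α : Type*} {v u z : List α} (h : v <+: u ++ z) :
    v <+: u ∨ ∃ w, v = u ++ w ∧ w <+: z := by
  rcases List.prefix_or_prefix_of_prefix h (List.prefix_append u z) with h' | ⟨w, rfl⟩
  · exact Or.inl h'
  · exact Or.inr ⟨w, rfl, (List.prefix_append_right_inj u).1 h⟩

/-- The words `v` whose number of pushed digits differs from `K` times the length by at most `D`. -/
def IsSynchronized (Y : A → ℕ) (K D : ℕ) (v : List A) : Prop :=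
  v.length * K ≤ digitCount Y v + D ∧ digitCount Y v ≤ v.length * K + D

/-- The nonempty words all of whose prefixes are synchronized up to `K`, and all of whose letters
but the first are in `G`. -/
def synchronizedWords (Y : A → ℕ) (K : ℕ) (G : Set A) : Language A :=
  {u | u ≠ [] ∧ (∀ v, v <+: u → IsSynchronized Y K K v) ∧ ∀ a ∈ u.tail, a ∈ G}

/-- Reading from the left, it suffices to remember whether the prefix is empty and its deviation
`digitCount - length * K`, which lies in `[-K, K]`. -/
theorem isRegular_synchronizedWords (Y : A → ℕ) (K : ℕ) (G : Set A) :
    (synchronizedWords Y K G).IsRegular := by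
  rw [Language.isRegular_iff_finite_range_leftQuotient]
  refine Set.finite_range_of_rel _
    ((Set.finite_univ (α := Prop)).prod (Set.finite_Icc (-(K : ℤ)) K))
    (fun u q => q = ((u = [] : Prop), ((digitCount Y u) : ℤ) - u.length * K) ∧
      (∀ v, v <+: u → IsSynchronized Y K K v) ∧ ∀ a ∈ u.tail, a ∈ G) (fun u z hz => ?_) ?_
  · obtain ⟨-, h2, h3⟩ := hz
    have hpre : ∀ v, v <+: u → IsSynchronized Y K K v := fun v hv =>
      h2 v (hv.trans (List.prefix_append u z))
    have hu := hpre u List.prefix_rfl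
    unfold IsSynchronized at hu
    zify at hu
    refine ⟨_, ⟨trivial, ?_⟩, rfl, hpre, fun a ha => h3 a ?_⟩
    · simp only [Set.mem_Icc]
      constructor <;> linarith
    · cases u with
      | nil => simp at ha
      | cons b u =>
        simp only [List.tail_cons, List.cons_append] at ha ⊢
        exact List.mem_append_left _ ha
  · rintro u u' q ⟨rfl, -, -⟩ ⟨hq, h2', h3'⟩ z ⟨h1, h2, h3⟩
    simp only [Prod.mk.injEq, eq_iff_iff] at hq
    obtain ⟨hnil, hsum⟩ := hq
    have hsync : ∀ v, v <+: u' ++ z → IsSynchronized Y K K v := by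
      intro v hv
      rcases prefix_append_cases hv with h | ⟨w, rfl, hw⟩
      · exact h2' v h
      · have := h2 (u ++ w) ((List.prefix_append_right_inj u).2 hw)
        unfold IsSynchronized at this ⊢
        simp only [List.length_append, digitCount_append, add_mul] at this ⊢
        zify at this ⊢
        constructor <;> linarith [this.1, this.2]
    refine ⟨?_, hsync, fun a ha => ?_⟩
    · by_cases hu : u = []
      · rw [hnil.1 hu]; rw [hu] at h1; exact h1
      · exact List.append_ne_nil_of_left_ne_nil (fun h => hu (hnil.2 h)) z
    · by_cases hu : u = []
      · rw [hnil.1 hu] at ha; rw [hu] at h3; exact h3 a ha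
      · have hu' : u' ≠ [] := fun h => hu (hnil.2 h)
        rw [List.tail_append_of_ne_nil hu', List.mem_append] at ha
        rcases ha with ha | ha
        · exact h3' a ha
        · refine h3 a ?_
          rw [List.tail_append_of_ne_nil hu]
          exact List.mem_append_right _ ha

/-! ### Bounds along synchronized words -/

variable {K C D e N : ℕ} {G : Set A}

theorem fst_foldr_le (hG : ∀ a ∈ G, ∀ g, (act a g).1 ≤ max C g.1) {u : List A}
    (hu : ∀ a ∈ u, a ∈ G) (g : ℕ × List β) : (u.foldr act g).1 ≤ max C g.1 := by
  induction u with
  | nil => simp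
  | cons a u ih =>
    have h1 := hG a (hu a (by simp)) (u.foldr act g)
    have h2 := ih fun b hb => hu b (by simp [hb])
    rw [List.foldr_cons]
    omega

/-- Only the first letter may lie outside `G`, and it acts last, so the excess `D` occurs at most
once. -/
theorem fst_foldr_suffix_le (hG : ∀ a ∈ G, ∀ g, (act a g).1 ≤ max C g.1)
    (hD : ∀ a g, (act a g).1 ≤ max C g.1 + D) {u s : List A}
    (hu : u ∈ synchronizedWords Y K G) (hs : s <:+ u) (g : ℕ × List β) :
    (s.foldr act g).1 ≤ max C g.1 + D := by
  obtain ⟨h1, -, h3⟩ := hu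
  cases u with
  | nil => exact absurd rfl h1
  | cons a u =>
    rw [List.tail_cons] at h3
    rcases List.suffix_cons_iff.1 hs with rfl | hs
    · have h1 := hD a (u.foldr act g)
      have h2 := fst_foldr_le hG h3 g
      rw [List.foldr_cons]
      omega
    · have := fst_foldr_le hG (fun b hb => h3 b (hs.subset hb)) g
      omega

theorem foldr_shift {p : List A} (hp : ∀ a ∈ p, ∀ g, act a g = (g.1 + e, g.2))
    (g : ℕ × List β) : p.foldr act g = (g.1 + p.length * e, g.2) := by
  induction p with
  | nil => simp
  | cons a p ih =>
    rw [List.foldr_cons, ih fun b hb => hp b (by simp [hb]), hp a (by simp), List.length_cons]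
    simp only [Prod.mk.injEq, and_true]
    ring

theorem digitCount_eq_zero (hact : ∀ a, PushesDigits (Y a) (act a)) {p : List A}
    (hp : ∀ a ∈ p, ∀ g, act a g = (g.1 + e, g.2)) : digitCount Y p = 0 := by
  have := (pushesDigits_foldr hact p).2 0
  simp only [foldr_shift hp] at this
  simpa using this.symm

/-- The letters of `p` push no digit, so they add at most `N * K` to the deviation. -/
theorem isSynchronized_of_prefix (hact : ∀ a, PushesDigits (Y a) (act a)) {p u v : List A}
    (hp : ∀ a ∈ p, ∀ g, act a g = (g.1 + e, g.2)) (hpN : p.length ≤ N)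
    (hu : u ∈ synchronizedWords Y K G) (hv : v <+: p ++ u) :
    IsSynchronized Y K ((N + 1) * K) v := by
  have hpK := Nat.mul_le_mul_right K hpN
  rcases prefix_append_cases hv with h | ⟨w, rfl, hw⟩
  · have h0 := digitCount_eq_zero hact (p := v) (e := e) fun a ha => hp a (h.subset ha)
    have h1 := Nat.mul_le_mul_right K h.length_le
    simp only [IsSynchronized, h0, add_mul]
    omega
  · have h0 := digitCount_eq_zero hact hp
    have h1 := hu.2.1 w hw
    simp only [IsSynchronized, digitCount_append, List.length_append, h0, add_mul] at h1 ⊢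
    omega

theorem fst_foldr_suffix_append_le (hG : ∀ a ∈ G, ∀ g, (act a g).1 ≤ max C g.1)
    (hD : ∀ a g, (act a g).1 ≤ max C g.1 + D) {p u s : List A}
    (hp : ∀ a ∈ p, ∀ g, act a g = (g.1 + e, g.2)) (hpN : p.length ≤ N)
    (hu : u ∈ synchronizedWords Y K G) (hs : s <:+ p ++ u) (g : ℕ × List β) :
    (s.foldr act g).1 ≤ max C g.1 + D + N * e := by
  rcases List.suffix_or_suffix_of_suffix hs (List.suffix_append p u) with h | ⟨q, rfl⟩
  · exact (fst_foldr_suffix_le hG hD hu h g).trans (Nat.le_add_right _ _)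
  · obtain ⟨w, hw⟩ := hs
    have hq : q <:+ p := ⟨w, List.append_cancel_right (by rw [← hw, List.append_assoc])⟩
    have h1 := fst_foldr_suffix_le hG hD hu List.suffix_rfl g
    have h2 := Nat.mul_le_mul_right e (hq.length_le.trans hpN)
    rw [List.foldr_append, foldr_shift (e := e) fun a ha => hp a (hq.subset ha)]
    simp only
    omega

/-- The remaining left parts `u'` and `v'` complete both digit lists to the same list, so one list
is a suffix of the other, and the lengths differ as the digit counts of `u'` and `v'` do.
Synchronization compares these counts with `min i u.length * K` and `min i v.length * K`, and
equality of the final lists compares `u.length * K` with `v.length * K`; four comparisons cost `4 *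
D`. -/
theorem exists_common_digits (hact : ∀ a, PushesDigits (Y a) (act a)) {D : ℕ}
    {u u' v v' s t : List A} {i : ℕ} {g h : ℕ × List β} (hu : u = u' ++ s) (hv : v = v' ++ t)
    (hsu : ∀ w, w <+: u → IsSynchronized Y K D w) (hsv : ∀ w, w <+: v → IsSynchronized Y K D w)
    (hu' : u'.length = min i u.length) (hv' : v'.length = min i v.length)
    (heq : u.foldr act g = v.foldr act h) :
    ∃ d d' l, (s.foldr act g).2 = d ++ l ∧ (t.foldr act h).2 = d' ++ l ∧
      d.length ≤ 4 * D + g.2.length + h.2.length ∧ d'.length ≤ 4 * D + g.2.length + h.2.length := by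
  have hlen := congrArg (fun f => f.2.length) heq
  simp only [(pushesDigits_foldr hact u).length_snd g, (pushesDigits_foldr hact v).length_snd h]
    at hlen
  have h1 := hsu u List.prefix_rfl
  have h2 := hsv v List.prefix_rfl
  have h3 := hsu u' ⟨s, hu.symm⟩
  have h4 := hsv v' ⟨t, hv.symm⟩
  have hmul : ∀ a b : ℕ, min a b * K = min (a * K) (b * K) :=
    fun a b => (Nat.mul_min_mul_right a b K).symm
  have hbound : digitCount Y u' ≤ digitCount Y v' + (4 * D + g.2.length + h.2.length) ∧
      digitCount Y v' ≤ digitCount Y u' + (4 * D + g.2.length + h.2.length) := by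
    unfold IsSynchronized at h1 h2 h3 h4
    rw [hu', hmul] at h3
    rw [hv', hmul] at h4
    generalize u.length * K = a at *
    generalize v.length * K = b at *
    generalize i * K = c at *
    omega
  rw [hu, hv, List.foldr_append, List.foldr_append] at heq
  obtain ⟨X, hX, hXe⟩ := (pushesDigits_foldr hact u').exists_snd_eq (s.foldr act g)
  obtain ⟨X', hX', hXe'⟩ := (pushesDigits_foldr hact v').exists_snd_eq (t.foldr act h)
  rw [heq, hXe'] at hXe
  rcases List.append_eq_append_iff.1 hXe with ⟨a, ha, ha'⟩ | ⟨a, ha, ha'⟩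
  · refine ⟨[], a, (s.foldr act g).2, by simp, ha', by simp, ?_⟩
    have := congrArg List.length ha
    rw [List.length_append] at this
    omega
  · refine ⟨a, [], (t.foldr act h).2, ha', by simp, ?_, by simp⟩
    have := congrArg List.length ha
    rw [List.length_append] at this
    omega

/-- The padded words of the pairs of words of `L` that send `g` and `h` to the same pair and of
which at least one is in `L'`. -/
def coincidenceLanguage (act : A → ℕ × List β → ℕ × List β) (L L' : Language A)
    (g h : ℕ × List β) : Language (PaddedPair A) :=
  {z | ∃ u ∈ L, ∃ v ∈ L, (u ∈ L' ∨ v ∈ L') ∧ u.foldr act g = v.foldr act h ∧ z = paddedWord u v}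

/-- A word in the synchronized language ends at a bounded number. The other word ends at the same
number, so it has boundedly many leading shifts (here `0 < e` matters). All numbers and digit
discrepancies met on the way are then bounded. -/
theorem isRegular_coincidenceLanguage [Finite A] [Finite β] {L : Language A} (he : 0 < e)
    (hact : ∀ a, PushesDigits (Y a) (act a)) (hG : ∀ a ∈ G, ∀ g, (act a g).1 ≤ max C g.1)
    (hD : ∀ a g, (act a g).1 ≤ max C g.1 + D) (hL : L.IsRegular)
    (hLe : ∀ u ∈ L, ∃ p v, u = p ++ v ∧ v ∈ synchronizedWords Y K G ∧
      ∀ a ∈ p, ∀ g, act a g = (g.1 + e, g.2)) (g h : ℕ × List β) :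
    (coincidenceLanguage act L (synchronizedWords Y K G) g h).IsRegular := by
  have hS := Language.isRegular_iff_finite_range_leftContext.1 (isRegular_synchronizedWords Y K G)
  rw [Language.isRegular_iff_finite_range_leftContext] at hL ⊢
  obtain ⟨N, hN⟩ : ∃ N, N = max C (max g.1 h.1) + D := ⟨_, rfl⟩
  obtain ⟨M, hM⟩ : ∃ M, M = 4 * ((N + 1) * K) + g.2.length + h.2.length := ⟨_, rfl⟩
  have hlists := List.finite_length_le β M
  -- The state of a right half: the left contexts of both tracks for both languages, the first
  -- padded letter, and on each track the number with the digits above a common tail `l`.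
  refine Set.finite_range_of_rel _ (hL.prod <| hS.prod <| hL.prod <| hS.prod <|
      (Set.finite_univ (α := Option (PaddedPair A))).prod <|
      ((Set.finite_Iic (N + N * e)).prod hlists).prod ((Set.finite_Iic (N + N * e)).prod hlists))
    (fun z q => z.IsChain PaddingPersists ∧
      q.1 = L.leftContext (firstTrack z) ∧
      q.2.1 = (synchronizedWords Y K G).leftContext (firstTrack z) ∧
      q.2.2.1 = L.leftContext (secondTrack z) ∧
      q.2.2.2.1 = (synchronizedWords Y K G).leftContext (secondTrack z) ∧
      q.2.2.2.2.1 = z.head? ∧ ∃ l,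
        (firstTrack z).foldr act g = (q.2.2.2.2.2.1.1, q.2.2.2.2.2.1.2 ++ l) ∧
        (secondTrack z).foldr act h = (q.2.2.2.2.2.2.1, q.2.2.2.2.2.2.2 ++ l)) ?_ ?_
  · rintro z y ⟨u, hu, v, hv, huv, heq, hz⟩
    have hchain := isChain_paddedWord u v
    rw [← hz] at hchain
    have hu1 : u = firstTrack y ++ firstTrack z := by
      rw [← firstTrack_append, hz, firstTrack_paddedWord]
    have hv1 : v = secondTrack y ++ secondTrack z := by
      rw [← secondTrack_append, hz, secondTrack_paddedWord]
    have hyt : y = (paddedWord u v).take y.length := by rw [← hz]; simp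
    have hyu : (firstTrack y).length = min y.length u.length := by
      conv_lhs => rw [hyt, firstTrack_take_paddedWord, List.length_take]
    have hyv : (secondTrack y).length = min y.length v.length := by
      conv_lhs => rw [hyt, secondTrack_take_paddedWord, List.length_take]
    obtain ⟨p, u0, hpu, hu0, hp, hpN, q, v0, hqv, hv0, hq, hqN⟩ :
        ∃ p u0, u = p ++ u0 ∧ u0 ∈ synchronizedWords Y K G ∧
          (∀ a ∈ p, ∀ g, act a g = (g.1 + e, g.2)) ∧ p.length ≤ N ∧
        ∃ q v0, v = q ++ v0 ∧ v0 ∈ synchronizedWords Y K G ∧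
          (∀ a ∈ q, ∀ g, act a g = (g.1 + e, g.2)) ∧ q.length ≤ N := by
      rcases huv with h0 | h0
      · obtain ⟨q, v0, hqv, hv0, hq⟩ := hLe v hv
        refine ⟨[], u, rfl, h0, by simp, by simp, q, v0, hqv, hv0, hq, ?_⟩
        have h1 := fst_foldr_suffix_le hG hD h0 List.suffix_rfl g
        rw [heq, hqv, List.foldr_append, foldr_shift hq] at h1
        have h2 := Nat.le_mul_of_pos_right q.length he
        simp only at h1
        omega
      · obtain ⟨p, u0, hpu, hu0, hp⟩ := hLe u hu
        refine ⟨p, u0, hpu, hu0, hp, ?_, [], v, rfl, h0, by simp, by simp⟩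
        have h1 := fst_foldr_suffix_le hG hD h0 List.suffix_rfl h
        rw [← heq, hpu, List.foldr_append, foldr_shift hp] at h1
        have h2 := Nat.le_mul_of_pos_right p.length he
        simp only at h1
        omega
    obtain ⟨d, d', l, hd, hd', hdM, hdM'⟩ := exists_common_digits hact hu1 hv1
      (fun w hw => isSynchronized_of_prefix hact hp hpN hu0 (hpu ▸ hw))
      (fun w hw => isSynchronized_of_prefix hact hq hqN hv0 (hqv ▸ hw)) hyu hyv heq
    have hb := fst_foldr_suffix_append_le hG hD hp hpN hu0
      (s := firstTrack z) (hpu ▸ hu1 ▸ List.suffix_append _ _) g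
    have hb' := fst_foldr_suffix_append_le hG hD hq hqN hv0
      (s := secondTrack z) (hqv ▸ hv1 ▸ List.suffix_append _ _) h
    refine ⟨(_, _, _, _, _, (((firstTrack z).foldr act g).1, d),
      (((secondTrack z).foldr act h).1, d')), ?_,
      (List.isChain_append.1 hchain).2.1, rfl, rfl, rfl, rfl, rfl, l, ?_, ?_⟩
    · refine ⟨⟨_, rfl⟩, ⟨_, rfl⟩, ⟨_, rfl⟩, ⟨_, rfl⟩, trivial, ⟨?_, ?_⟩, ?_, ?_⟩
      · simp only [Set.mem_Iic]; omega
      · simp only [Set.mem_ofPred_eq]; omega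
      · simp only [Set.mem_Iic]; omega
      · simp only [Set.mem_ofPred_eq]; omega
    · exact Prod.ext rfl hd
    · exact Prod.ext rfl hd'
  · rintro z z' ⟨q1, q2, q3, q4, q5, ⟨c, d⟩, c', d'⟩ ⟨-, h1, h2, h3, h4, h5, l, h6, h7⟩
      ⟨hc', h1', h2', h3', h4', h5', l', h6', h7'⟩ y ⟨u, hu, v, hv, huv, heq, hz⟩
    simp only at h1 h2 h3 h4 h5 h6 h7 h1' h2' h3' h4' h5' h6' h7'
    have hchain := isChain_paddedWord u v
    rw [← hz, List.isChain_append] at hchain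
    have hu1 : u = firstTrack y ++ firstTrack z := by
      rw [← firstTrack_append, hz, firstTrack_paddedWord]
    have hv1 : v = secondTrack y ++ secondTrack z := by
      rw [← secondTrack_append, hz, secondTrack_paddedWord]
    subst hu1 hv1
    rw [h1] at h1'
    rw [h2] at h2'
    rw [h3] at h3'
    rw [h4] at h4'
    rw [h5] at h5'
    refine ⟨firstTrack y ++ firstTrack z', ?_, secondTrack y ++ secondTrack z', ?_, ?_, ?_, ?_⟩
    · rw [← Language.mem_leftContext] at hu ⊢; rwa [← h1']
    · rw [← Language.mem_leftContext] at hv ⊢; rwa [← h3']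
    · rw [← Language.mem_leftContext, ← Language.mem_leftContext] at huv ⊢; rwa [← h2', ← h4']
    · rw [List.foldr_append, List.foldr_append, h6, h7] at heq
      rw [List.foldr_append, List.foldr_append, h6', h7']
      -- Whether the left half completes to a coincidence depends only on `(c, d)` and `(c', d')`,
      -- not on the tail `l` or `l'`.
      have key := (pushesDigits_foldr hact (firstTrack y)).eq_append_iff
        (pushesDigits_foldr hact (secondTrack y)) c c' d d'
      exact (key l').2 ((key l).1 heq)
    · rw [← firstTrack_append, ← secondTrack_append, paddedWord_tracks]
      rw [List.isChain_append, ← h5']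
      exact ⟨hchain.1, hc', hchain.2.2⟩

/-- Shifts are injective, so the shorter leading power of `a` cancels from both words and one of
them is left in `L`. -/
theorem coincidenceLanguage_prependPowers {a : A}
    (ha : ∀ g, act a g = (g.1 + e, g.2)) (L : Language A) (g h : ℕ × List β) :
    coincidenceLanguage act (L.prependPowers a) (L.prependPowers a) g h =
      (coincidenceLanguage act (L.prependPowers a) L g h).prependPowers
        ⟨(some a, some a), by simp⟩ := by
  have hrep : ∀ i, ∀ b ∈ List.replicate i a, ∀ g : ℕ × List β, act b g = (g.1 + e, g.2) :=
    fun i b hb => by rw [List.eq_of_mem_replicate hb]; exact ha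
  have hcancel : ∀ i (u v : List A), (List.replicate i a ++ u).foldr act g =
      (List.replicate i a ++ v).foldr act h ↔ u.foldr act g = v.foldr act h := by
    intro i u v
    rw [List.foldr_append, List.foldr_append, foldr_shift (hrep i), foldr_shift (hrep i)]
    simp [Prod.ext_iff]
  ext z
  constructor
  · rintro ⟨_, ⟨i, u, hu, rfl⟩, _, ⟨j, v, hv, rfl⟩, -, heq, rfl⟩
    rcases Nat.le_total i j with hij | hij
    · obtain ⟨k, rfl⟩ := Nat.exists_eq_add_of_le hij
      rw [List.replicate_add, List.append_assoc] at heq ⊢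
      rw [paddedWord_replicate_append]
      exact ⟨i, _, ⟨u, ⟨0, u, hu, by simp⟩, _, ⟨k, v, hv, rfl⟩, Or.inl hu,
        (hcancel _ _ _).1 heq, rfl⟩, rfl⟩
    · obtain ⟨k, rfl⟩ := Nat.exists_eq_add_of_le hij
      rw [List.replicate_add, List.append_assoc] at heq ⊢
      rw [paddedWord_replicate_append]
      exact ⟨j, _, ⟨_, ⟨k, u, hu, rfl⟩, v, ⟨0, v, hv, by simp⟩, Or.inr hv,
        (hcancel _ _ _).1 heq, rfl⟩, rfl⟩
  · rintro ⟨k, _, ⟨_, ⟨i, u, hu, rfl⟩, _, ⟨j, v, hv, rfl⟩, -, heq, rfl⟩, rfl⟩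
    have hu' : List.replicate k a ++ (List.replicate i a ++ u) ∈ L.prependPowers a :=
      ⟨k + i, u, hu, by rw [List.replicate_add, List.append_assoc]⟩
    have hv' : List.replicate k a ++ (List.replicate j a ++ v) ∈ L.prependPowers a :=
      ⟨k + j, v, hv, by rw [List.replicate_add, List.append_assoc]⟩
    exact ⟨_, hu', _, hv', Or.inl hu', (hcancel _ _ _).2 heq,
      (paddedWord_replicate_append _ _ _ _).symm⟩

end Action

/-! ### Right-automaticity from a faithful action -/

namespace FreeSemigroup

variable {A : Type*}

theorem letters_of (a : A) : (of a).letters = [a] := rfl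

theorem letters_mul (u v : FreeSemigroup A) : (u * v).letters = u.letters ++ v.letters := rfl

theorem exists_letters_eq {l : List A} (hl : l ≠ []) : ∃ w : FreeSemigroup A, w.letters = l := by
  cases l with
  | nil => exact absurd rfl hl
  | cons a l => exact ⟨⟨a, l⟩, rfl⟩

theorem lift_apply_eq_foldr {S M : Type*} [Semigroup S] {ρ : S → M → M}
    (hρ : ∀ s t g, ρ (s * t) g = ρ s (ρ t g)) (φ : A → S) (w : FreeSemigroup A) (g : M) :
    ρ (lift φ w) g = w.letters.foldr (fun a => ρ (φ a)) g := by
  induction w using FreeSemigroup.recOnMul generalizing g with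
  | ih1 a => simp [letters_of]
  | ih2 a w iha ihw => rw [map_mul, hρ, letters_mul, List.foldr_append, ← ihw, ← iha]

end FreeSemigroup

/-- Right multiplication by `a` only changes the starting point of the action from `(0, [])` to `a ·
(0, [])`, so equality and multiplication are both coincidence languages. -/
theorem isRightAutomatic_of_coincidenceLanguage {T A : Type} {β : Type*} [Semigroup T] [Finite A]
    (ρ : T → ℕ × List β → ℕ × List β) (hmul : ∀ s t g, ρ (s * t) g = ρ s (ρ t g))
    (hρ : ∀ s t, ρ s (0, []) = ρ t (0, []) → s = t) (φ : A → T) (L : Language A)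
    (hL : L.IsRegular) (hne : ∀ u ∈ L, u ≠ [])
    (hsurj : ∀ t, ∃ u ∈ L, ∀ g, ρ t g = u.foldr (fun a => ρ (φ a)) g)
    (hrel : ∀ g h, (coincidenceLanguage (fun a => ρ (φ a)) L L g h).IsRegular) :
    IsRightAutomatic T := by
  have hsurj' : FreeSemigroup.lift φ '' {w | w.letters ∈ L} = Set.univ := by
    refine Set.eq_univ_of_forall fun t => ?_
    obtain ⟨u, hu, ht⟩ := hsurj t
    obtain ⟨w, rfl⟩ := FreeSemigroup.exists_letters_eq (hne u hu)
    exact ⟨w, hu, hρ _ _ (by rw [FreeSemigroup.lift_apply_eq_foldr hmul, ht])⟩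
  have hpad : ∀ R : FreeSemigroup A → FreeSemigroup A → Prop, ∀ g h,
      (∀ u v, R u v ↔ u.letters.foldr (fun a => ρ (φ a)) g =
        v.letters.foldr (fun a => ρ (φ a)) h) →
      (paddedLanguage {p | p.1 ∈ {w : FreeSemigroup A | w.letters ∈ L} ∧
        p.2 ∈ {w : FreeSemigroup A | w.letters ∈ L} ∧ R p.1 p.2}).IsRegular := by
    intro R g h hR
    convert hrel g h using 1
    ext z
    constructor
    · rintro ⟨⟨u, v⟩, ⟨hu, hv, huv⟩, rfl⟩
      exact ⟨_, hu, _, hv, Or.inl hu, (hR u v).1 huv, rfl⟩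
    · rintro ⟨u, hu, v, hv, -, huv, rfl⟩
      obtain ⟨u, rfl⟩ := FreeSemigroup.exists_letters_eq (hne u hu)
      obtain ⟨v, rfl⟩ := FreeSemigroup.exists_letters_eq (hne v hv)
      exact ⟨(u, v), ⟨hu, hv, (hR u v).2 huv⟩, rfl⟩
  have heq : ∀ s t, s = t ↔ ρ s (0, []) = ρ t (0, []) := fun s t =>
    ⟨fun h => by rw [h], hρ s t⟩
  refine ⟨A, φ, {w | w.letters ∈ L}, ‹_›, ?_, ?_, hsurj', ?_, fun a => ?_⟩
  · refine eq_top_iff.2 fun t _ => ?_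
    obtain ⟨w, -, rfl⟩ : t ∈ FreeSemigroup.lift φ '' {w | w.letters ∈ L} := hsurj' ▸ trivial
    induction w using FreeSemigroup.recOnMul with
    | ih1 a => exact Subsemigroup.subset_closure ⟨a, by simp⟩
    | ih2 a w iha ihw => rw [map_mul]; exact mul_mem (iha trivial) (ihw trivial)
  · convert hL using 1
    ext u
    constructor
    · rintro ⟨w, hw, rfl⟩
      exact hw
    · intro hu
      obtain ⟨w, rfl⟩ := FreeSemigroup.exists_letters_eq (hne u hu)
      exact ⟨w, hu, rfl⟩
  · refine hpad (fun u v => FreeSemigroup.lift φ u = FreeSemigroup.lift φ v) (0, []) (0, [])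
      fun u v => ?_
    rw [heq, FreeSemigroup.lift_apply_eq_foldr hmul, FreeSemigroup.lift_apply_eq_foldr hmul]
  · refine hpad (fun u v => FreeSemigroup.lift φ (u * .of a) = FreeSemigroup.lift φ v)
      (ρ (φ a) (0, [])) (0, []) fun u v => ?_
    rw [heq, FreeSemigroup.lift_apply_eq_foldr hmul, FreeSemigroup.lift_apply_eq_foldr hmul,
      FreeSemigroup.letters_mul, FreeSemigroup.letters_of, List.foldr_append]
    rfl

/-! ### The action of a Baumslag–Solitar semigroup on normal forms -/

section BaumslagSolitar

variable {m n : ℕ}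

/-- Left multiplication of the normal form `x ^ c y x ^ b₁ y x ^ b₂ ⋯`, given as `(c, [b₁, b₂, …])`,
by a generator. -/
def BSGen.act (m n : ℕ) [NeZero m] : BSGen → ℕ × List (Fin m) → ℕ × List (Fin m)
  | .x => fun g => (g.1 + 1, g.2)
  | .y => fun g => (n * (g.1 / m), Fin.ofNat m g.1 :: g.2)

namespace BSSemigroup

/-- The element of the semigroup represented by a word. -/
def mk (m n : ℕ) : FreeSemigroup BSGen →ₙ* BSSemigroup m n where
  toFun w := ((w : (conGen (BSRel m n)).Quotient))
  map_mul' _ _ := rfl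

theorem mk_surjective (m n : ℕ) : Function.Surjective (mk m n) := Quotient.mk_surjective

theorem mk_eq_mk {u v : FreeSemigroup BSGen} : mk m n u = mk m n v ↔ conGen (BSRel m n) u v :=
  Con.eq _

@[elab_as_elim]
theorem induction {p : BSSemigroup m n → Prop} (gen : ∀ a, p (mk m n (.of a)))
    (mul : ∀ a s, p s → p (mk m n (.of a) * s)) (s : BSSemigroup m n) : p s := by
  obtain ⟨w, rfl⟩ := mk_surjective m n s
  induction w using FreeSemigroup.recOnMul with
  | ih1 a => exact gen a
  | ih2 a w _ ihw => rw [map_mul]; exact mul a _ ihw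

theorem coe_mk (w : FreeSemigroup BSGen) : (mk m n w : WithOne (BSSemigroup m n)) =
    (w.letters.map fun a => (mk m n (.of a) : WithOne (BSSemigroup m n))).prod := by
  induction w using FreeSemigroup.recOnMul with
  | ih1 a => simp [FreeSemigroup.letters_of]
  | ih2 a w iha ihw =>
    rw [map_mul, WithOne.coe_mul, ihw, FreeSemigroup.letters_mul, List.map_append,
      List.prod_append, ← iha]

theorem y_mul_x_pow : (mk m n (.of .y) : WithOne (BSSemigroup m n)) *
      (mk m n (.of .x) : WithOne (BSSemigroup m n)) ^ m =
    (mk m n (.of .x) : WithOne (BSSemigroup m n)) ^ n * (mk m n (.of .y)) := by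
  obtain ⟨u, hu⟩ := FreeSemigroup.exists_letters_eq
    (l := BSGen.y :: List.replicate m BSGen.x) (by simp)
  obtain ⟨v, hv⟩ := FreeSemigroup.exists_letters_eq
    (l := List.replicate n BSGen.x ++ [BSGen.y]) (by simp)
  have h : mk m n u = mk m n v := mk_eq_mk.2 (ConGen.Rel.of _ _ ⟨hu, hv⟩)
  have h' := congrArg (fun s : BSSemigroup m n => (s : WithOne (BSSemigroup m n))) h
  simpa only [coe_mk u, coe_mk v, hu, hv, List.map_cons, List.prod_cons, List.map_append,
    List.map_replicate, List.prod_replicate, List.prod_append, List.map_nil, List.prod_nil,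
    mul_one] using h'

theorem y_mul_x_pow_mul (q : ℕ) : (mk m n (.of .y) : WithOne (BSSemigroup m n)) *
      (mk m n (.of .x) : WithOne (BSSemigroup m n)) ^ (m * q) =
    (mk m n (.of .x) : WithOne (BSSemigroup m n)) ^ (n * q) * (mk m n (.of .y)) := by
  induction q with
  | zero => simp
  | succ q ih =>
    rw [mul_add, mul_add, pow_add, ← mul_assoc, ih, mul_assoc, mul_one, mul_one, y_mul_x_pow,
      ← mul_assoc, ← pow_add]

theorem foldr_act_replicate [NeZero m] (k : ℕ) (g : ℕ × List (Fin m)) :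
    (List.replicate k BSGen.x).foldr (BSGen.act m n) g = (g.1 + k, g.2) := by
  induction k with
  | zero => rfl
  | succ k ih => rw [List.replicate_succ, List.foldr_cons, ih]; rfl

theorem foldr_act_eq_of_conGen [NeZero m] {u v : FreeSemigroup BSGen}
    (h : conGen (BSRel m n) u v) (g : ℕ × List (Fin m)) :
    u.letters.foldr (BSGen.act m n) g = v.letters.foldr (BSGen.act m n) g := by
  replace h : ConGen.Rel (BSRel m n) u v := h
  induction h generalizing g with
  | of u v huv =>
    rw [huv.1, huv.2, List.foldr_cons, List.foldr_append, foldr_act_replicate,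
      foldr_act_replicate]
    simp only [BSGen.act, List.foldr_cons, List.foldr_nil, Prod.mk.injEq, List.cons.injEq,
      and_true]
    refine ⟨?_, ?_⟩
    · rw [Nat.add_div_right _ (Nat.pos_of_neZero m)]; ring
    · ext; simp
  | refl _ => rfl
  | symm _ ih => exact (ih g).symm
  | trans _ _ ih ih' => exact (ih g).trans (ih' g)
  | mul _ _ ih ih' =>
    rw [FreeSemigroup.letters_mul, FreeSemigroup.letters_mul, List.foldr_append,
      List.foldr_append, ih', ih]

/-- The action of the semigroup on normal forms by left multiplication. -/
def act (m n : ℕ) [NeZero m] (s : BSSemigroup m n) : ℕ × List (Fin m) → ℕ × List (Fin m) :=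
  Con.liftOn (c := conGen (BSRel m n)) s (fun w => w.letters.foldr (BSGen.act m n))
    fun _ _ h => funext (foldr_act_eq_of_conGen h)

variable [NeZero m]

theorem act_mk (w : FreeSemigroup BSGen) (g : ℕ × List (Fin m)) :
    act m n (mk m n w) g = w.letters.foldr (BSGen.act m n) g := rfl

theorem act_mk_of (a : BSGen) : act m n (mk m n (.of a)) = BSGen.act m n a := rfl

theorem act_mul (s t : BSSemigroup m n) (g : ℕ × List (Fin m)) :
    act m n (s * t) g = act m n s (act m n t g) := by
  obtain ⟨u, rfl⟩ := mk_surjective m n s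
  obtain ⟨v, rfl⟩ := mk_surjective m n t
  rw [← map_mul, act_mk, act_mk, act_mk, FreeSemigroup.letters_mul, List.foldr_append]

theorem exists_pushesDigits (s : BSSemigroup m n) : ∃ k, PushesDigits k (act m n s) := by
  have hgen : ∀ a, ∃ k, PushesDigits k (BSGen.act m n a) := by
    rintro (_ | _)
    · exact ⟨0, by simp [PushesDigits, BSGen.act]⟩
    · exact ⟨1, by simp [PushesDigits, BSGen.act]⟩
  induction s using induction with
  | gen a => exact hgen a
  | mul a s ih =>
    obtain ⟨k, hk⟩ := hgen a
    obtain ⟨k', hk'⟩ := ih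
    refine ⟨k + k', ?_⟩
    rw [show act m n (mk m n (.of a) * s) = BSGen.act m n a ∘ act m n s from funext (act_mul _ s)]
    exact hk.comp hk'

/-- The number of letters `y` in the words that represent an element. -/
def digits (s : BSSemigroup m n) : ℕ := (act m n s (0, [])).2.length

theorem pushesDigits (s : BSSemigroup m n) : PushesDigits (digits s) (act m n s) := by
  obtain ⟨k, hk⟩ := exists_pushesDigits s
  rwa [digits, hk.2]

theorem digits_mul (s t : BSSemigroup m n) : digits (s * t) = digits s + digits t := by
  rw [digits, act_mul, (pushesDigits s).length_snd]
  rfl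

theorem digits_x : digits (mk m n (.of .x)) = 0 := rfl

theorem digits_y : digits (mk m n (.of .y)) = 1 := rfl

/-- The word with a given normal form, as an element of the semigroup with an identity adjoined. -/
def ofNormalForm (g : ℕ × List (Fin m)) : WithOne (BSSemigroup m n) :=
  (mk m n (.of .x) : WithOne (BSSemigroup m n)) ^ g.1 *
    (g.2.map fun b : Fin m => (mk m n (.of .y) : WithOne (BSSemigroup m n)) *
      (mk m n (.of .x) : WithOne (BSSemigroup m n)) ^ (b : ℕ)).prod

/-- For the generator `y`, write `c = m * (c / m) + c % m` and move `y` across the first part by the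
defining relation. -/
theorem coe_mul_ofNormalForm (s : BSSemigroup m n) (g : ℕ × List (Fin m)) :
    (s : WithOne (BSSemigroup m n)) * ofNormalForm g = ofNormalForm (act m n s g) := by
  have hgen : ∀ a (g : ℕ × List (Fin m)),
      (mk m n (.of a) : WithOne (BSSemigroup m n)) * ofNormalForm g =
        ofNormalForm (BSGen.act m n a g) := by
    rintro (_ | _) ⟨c, l⟩
    · simp only [ofNormalForm, BSGen.act]
      rw [pow_succ', mul_assoc]
    · simp only [ofNormalForm, BSGen.act, List.map_cons, List.prod_cons]
      conv_lhs => rw [← Nat.div_add_mod c m, pow_add]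
      simp only [← mul_assoc, y_mul_x_pow_mul, Fin.val_ofNat]
  induction s using induction generalizing g with
  | gen a => exact hgen a g
  | mul a s ih => rw [WithOne.coe_mul, mul_assoc, ih, hgen, act_mul]; rfl

/-- `(0, [])` is the normal form of the adjoined identity, so its image under `s` is a normal form
of `s`. -/
theorem act_injective {s t : BSSemigroup m n} (h : act m n s (0, []) = act m n t (0, [])) :
    s = t := by
  have hs := coe_mul_ofNormalForm s (0, [])
  have ht := coe_mul_ofNormalForm t (0, [])
  rw [h, ← ht] at hs
  simpa [ofNormalForm] using hs

/-! ### Growth of the number under the action -/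

theorem fst_add_length_pos (s : BSSemigroup m n) (g : ℕ × List (Fin m)) :
    0 < (act m n s g).1 + (act m n s g).2.length := by
  have hgen : ∀ a (g : ℕ × List (Fin m)),
      0 < (BSGen.act m n a g).1 + (BSGen.act m n a g).2.length := by
    rintro (_ | _) g <;> simp only [BSGen.act, List.length_cons] <;> omega
  induction s using induction with
  | gen a => exact hgen a g
  | mul a s ih => rw [act_mul]; exact hgen a _

/-- This is `s x ^ (j m ^ k) = x ^ (j n ^ k) s` with `k = digits s`: it carries surplus powers of
`x` to the left. -/
theorem act_add_mul_pow (s : BSSemigroup m n) (c j : ℕ) (l : List (Fin m)) :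
    act m n s (c + j * m ^ digits s, l) =
      ((act m n s (c, l)).1 + j * n ^ digits s, (act m n s (c, l)).2) := by
  have hm : 0 < m := Nat.pos_of_neZero m
  have hy : ∀ g : ℕ × List (Fin m), ∀ i, BSGen.act m n .y (g.1 + i * m, g.2) =
      ((BSGen.act m n .y g).1 + i * n, (BSGen.act m n .y g).2) := by
    rintro ⟨c, l⟩ i
    simp only [BSGen.act, Nat.add_mul_div_right _ _ hm, mul_add, Prod.mk.injEq, List.cons.injEq,
      and_true]
    refine ⟨by ring, ?_⟩
    ext; simp
  induction s using induction generalizing c j with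
  | gen a =>
    cases a with
    | x =>
      rw [digits_x, act_mk_of]
      simp only [BSGen.act, pow_zero, mul_one, Prod.mk.injEq, and_true]
      ring
    | y =>
      rw [digits_y, act_mk_of, pow_one, pow_one]
      exact hy (c, l) j
  | mul a s ih =>
    cases a with
    | x =>
      rw [digits_mul, digits_x, zero_add, act_mul, act_mul, ih, act_mk_of]
      simp only [BSGen.act, Prod.mk.injEq, and_true]
      ring
    | y =>
      rw [digits_mul, digits_y, act_mul, act_mul, act_mk_of,
        show j * m ^ (1 + digits s) = (j * m) * m ^ digits s by ring, ih,
        show j * m * n ^ digits s = (j * n ^ digits s) * m by ring, hy,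
        show j * n ^ digits s * n = j * n ^ (1 + digits s) by ring]

theorem exists_act_eq_shift {s : BSSemigroup m n} (hs : digits s = 0) :
    ∃ i, 0 < i ∧ ∀ g, act m n s g = (g.1 + i, g.2) := by
  have h0 := fst_add_length_pos s (0, [])
  have hlen : (act m n s (0, [])).2.length = 0 := hs
  refine ⟨(act m n s (0, [])).1, by omega, fun ⟨c, l⟩ => ?_⟩
  have h := act_add_mul_pow s 0 c l
  rw [hs, pow_zero, pow_zero, mul_one, zero_add] at h
  rw [h, (pushesDigits s).1, List.eq_nil_of_length_eq_zero hlen]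
  simp [add_comm]

/-- A letter `y` replaces `c` by at most `n c / m`, and `n + 1 ≤ m` leaves room for the extra
summand `g.1`; this gain survives further letters, each adding at most a constant. -/
theorem exists_fst_act_le (hmn : n < m) (s : BSSemigroup m n) :
    (∃ γ, ∀ g, (act m n s g).1 ≤ γ + g.1) ∧
      (0 < digits s → ∃ γ, ∀ g, m * (act m n s g).1 + g.1 ≤ m * (γ + g.1)) := by
  have hy : ∀ c : ℕ, m * (n * (c / m)) ≤ n * c := fun c => by
    have := Nat.mul_le_mul_left n (Nat.mul_div_le c m)
    linarith
  have hy' : ∀ c : ℕ, n * (c / m) ≤ c := fun c =>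
    (Nat.mul_le_mul_right _ hmn.le).trans (Nat.mul_div_le c m)
  induction s using induction with
  | gen a =>
    cases a with
    | x => exact ⟨⟨1, fun g => by rw [act_mk_of]; simp only [BSGen.act]; omega⟩,
        fun h => absurd h (by rw [digits_x]; simp)⟩
    | y =>
      refine ⟨⟨0, fun g => ?_⟩, fun _ => ⟨0, fun g => ?_⟩⟩
      · rw [act_mk_of]
        simpa [BSGen.act] using hy' g.1
      · rw [act_mk_of]
        simp only [BSGen.act]
        have := hy g.1
        nlinarith
  | mul a s ih =>
    obtain ⟨⟨γ, hγ⟩, ih'⟩ := ih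
    cases a with
    | x =>
      refine ⟨⟨γ + 1, fun g => ?_⟩, fun h => ?_⟩
      · rw [act_mul, act_mk_of]
        simp only [BSGen.act]
        have := hγ g
        omega
      · rw [digits_mul, digits_x, zero_add] at h
        obtain ⟨δ, hδ⟩ := ih' h
        refine ⟨δ + 1, fun g => ?_⟩
        rw [act_mul, act_mk_of]
        simp only [BSGen.act]
        have := hδ g
        linarith
    | y =>
      refine ⟨⟨γ, fun g => ?_⟩, fun _ => ⟨γ, fun g => ?_⟩⟩
      · rw [act_mul, act_mk_of]
        exact (hy' _).trans (hγ g)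
      · rw [act_mul, act_mk_of]
        simp only [BSGen.act]
        have h1 := hy (act m n s g).1
        have h2 := Nat.mul_le_mul_left n (hγ g)
        have h3 := Nat.mul_le_mul_right (γ + g.1) hmn
        nlinarith

end BSSemigroup

end BaumslagSolitar

/-! ### Subsemigroups of Baumslag–Solitar semigroups -/

/-- Take the least element of `P` in each residue class modulo `q`. -/
theorem Set.exists_bound_modEq (P : Set ℕ) {q : ℕ} (hq : 0 < q) :
    ∃ N, ∀ i ∈ P, ∃ j, ∃ i₀ ∈ P, i₀ ≤ N ∧ i = i₀ + j * q := by
  have key : ∀ r : ℕ, ∃ b, ∀ i ∈ P, i % q = r → ∃ j, ∃ i₀ ∈ P, i₀ ≤ b ∧ i = i₀ + j * q := by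
    intro r
    rcases Set.eq_empty_or_nonempty {i ∈ P | i % q = r} with h | h
    · exact ⟨0, fun i hi hr => absurd (show i ∈ {i ∈ P | i % q = r} from ⟨hi, hr⟩) (by simp [h])⟩
    · have hmem := Nat.sInf_mem h
      refine ⟨sInf {i ∈ P | i % q = r}, fun i hi hr => ?_⟩
      have hle : sInf {i ∈ P | i % q = r} ≤ i := Nat.sInf_le ⟨hi, hr⟩
      obtain ⟨j, hj⟩ := (Nat.modEq_iff_dvd' hle).1 (hmem.2.trans hr.symm)
      exact ⟨j, _, hmem.1, le_rfl, by rw [mul_comm j, ← hj]; omega⟩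
  choose b hb using key
  refine ⟨(Finset.range q).sup b, fun i hi => ?_⟩
  obtain ⟨j, i₀, h0, h1, h2⟩ := hb (i % q) i hi rfl
  exact ⟨j, i₀, h0, h1.trans (Finset.le_sup (Finset.mem_range.2 (Nat.mod_lt i hq))), h2⟩

/-- If `a < b`, the hypothesis reads `m * (b - a) + a ≤ m * γ`, and the left side is at least `b`.
-/
theorem le_max_of_contraction {m γ a b : ℕ} (hm : 0 < m) (h : m * b + a ≤ m * (γ + a)) :
    b ≤ max (m * γ) a := by
  by_contra! hlt
  rw [max_lt_iff] at hlt
  obtain ⟨d, rfl⟩ := Nat.exists_eq_add_of_lt hlt.2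
  have h1 : m * (d + 1) + a ≤ m * γ := by nlinarith
  have h2 : d + 1 ≤ m * (d + 1) := Nat.le_mul_of_pos_left _ hm
  omega

namespace BSSemigroup

variable {m n : ℕ} [NeZero m]

/-- The exponents of the powers of `x` that belong to `T`. -/
def xExponents (T : Subsemigroup (BSSemigroup m n)) : Set ℕ :=
  {i | ∃ t ∈ T, ∀ g, act m n t g = (g.1 + i, g.2)}

/-- The elements of `T` that push at most `K` digits and preserve every bound `≥ C`. -/
def contracting (T : Subsemigroup (BSSemigroup m n)) (K C : ℕ) : Set (BSSemigroup m n) :=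
  {t | t ∈ T ∧ digits t ≤ K ∧ ∀ g, (act m n t g).1 ≤ max C g.1}

variable {T : Subsemigroup (BSSemigroup m n)}

theorem add_mem_xExponents {i j : ℕ} (hi : i ∈ xExponents T) (hj : j ∈ xExponents T) :
    i + j ∈ xExponents T := by
  obtain ⟨s, hs, hsi⟩ := hi
  obtain ⟨t, ht, htj⟩ := hj
  refine ⟨s * t, mul_mem hs ht, fun g => ?_⟩
  rw [act_mul, htj, hsi]
  simp only [Prod.mk.injEq, and_true]
  ring

theorem mul_mem_xExponents {e : ℕ} (he : e ∈ xExponents T) (j : ℕ) :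
    (j + 1) * e ∈ xExponents T := by
  induction j with
  | zero => simpa using he
  | succ j ih =>
    rw [add_mul _ 1, one_mul]
    exact add_mem_xExponents ih he

theorem pos_of_mem_xExponents {i : ℕ} (hi : i ∈ xExponents T) : 0 < i := by
  obtain ⟨s, -, hs⟩ := hi
  have := fst_add_length_pos s (0, [])
  rw [hs] at this
  simpa using this

/-- The maps which apply a word in `G` and then add zero or the exponent of a power of `x` that
belongs to `T`. -/
def IsShiftedProduct (T : Subsemigroup (BSSemigroup m n)) (G : Set (BSSemigroup m n))
    (f : ℕ × List (Fin m) → ℕ × List (Fin m)) : Prop :=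
  ∃ i, (i = 0 ∨ i ∈ xExponents T) ∧ ∃ l : List (BSSemigroup m n), (∀ w ∈ l, w ∈ G) ∧
    ∀ g, f g = ((l.foldr (act m n) g).1 + i, (l.foldr (act m n) g).2)

theorem exists_contracting_bound (hmn : n < m) {F : Set (BSSemigroup m n)} (hF : F.Finite) :
    ∃ γ, ∀ w ∈ F, 0 < digits w →
      ∀ g, m * (act m n w g).1 + g.1 ≤ m * (γ + g.1) := by
  induction F, hF using Set.Finite.induction_on with
  | empty => exact ⟨0, by simp⟩
  | @insert w F _ _ ih =>
    obtain ⟨γ, hγ⟩ := ih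
    obtain ⟨δ, hδ⟩ : ∃ δ, 0 < digits w →
        ∀ g, m * (act m n w g).1 + g.1 ≤ m * (δ + g.1) := by
      by_cases h : 0 < digits w
      · obtain ⟨δ, hδ⟩ := (exists_fst_act_le hmn w).2 h
        exact ⟨δ, fun _ => hδ⟩
      · exact ⟨0, fun h' => absurd h' h⟩
    refine ⟨γ + δ, fun v hv h g => ?_⟩
    rcases hv with rfl | hv
    · have := hδ h g
      nlinarith [Nat.zero_le (m * γ)]
    · have := hγ v hv h g
      nlinarith [Nat.zero_le (m * δ)]

theorem exists_digits_bound {F : Set (BSSemigroup m n)} (hF : F.Finite) :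
    ∃ K, 0 < K ∧ ∀ w ∈ F, digits w ≤ K := by
  obtain ⟨K, hK⟩ := (hF.image digits).bddAbove
  exact ⟨K + 1, by omega, fun w hw => (hK ⟨w, hw, rfl⟩).trans (by omega)⟩

/-- Every element of a finitely generated subsemigroup acts as a product of contracting elements
of the subsemigroup, followed by a shift by zero or by the exponent of a power of `x` in the
subsemigroup. -/
theorem isShiftedProduct_act (hmn : n < m) {F : Set (BSSemigroup m n)} (hF : F.Finite)
    (hT : Subsemigroup.closure F = T) {e : ℕ} (he : (xExponents T).Nonempty → e ∈ xExponents T)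
    (he0 : 0 < e) : ∃ K C N, 0 < K ∧
      (∀ i ∈ xExponents T, ∃ j, ∃ i₀ ∈ xExponents T, i₀ ≤ N ∧ i = i₀ + j * e) ∧
      ∀ t ∈ T, IsShiftedProduct T (contracting T K C) (act m n t) := by
  have hm : 0 < m := Nat.pos_of_neZero m
  obtain ⟨K, hK0, hK⟩ := exists_digits_bound hF
  obtain ⟨γ, hγ⟩ := exists_contracting_bound hmn hF
  -- The factor `m ^ K` lets a multiple of the modulus pass any generator, and `e` keeps the result
  -- a multiple of `e`.
  obtain ⟨N, hN⟩ := Set.exists_bound_modEq (xExponents T) (q := e * m ^ K) (by positivity)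
  have hFT : F ⊆ T := hT ▸ Subsemigroup.subset_closure
  refine ⟨K, m * (γ + N), N, hK0, fun i hi => ?_, ?_⟩
  · obtain ⟨j, i₀, h1, h2, h3⟩ := hN i hi
    exact ⟨j * m ^ K, i₀, h1, h2, by rw [h3]; ring⟩
  -- Quantifying over `f` turns products into compositions, so only the generators in `F` need work.
  have hcomp : ∀ t ∈ Subsemigroup.closure F, ∀ f,
      IsShiftedProduct T (contracting T K (m * (γ + N))) f →
      IsShiftedProduct T (contracting T K (m * (γ + N))) (act m n t ∘ f) := by
    intro t ht
    induction ht using Subsemigroup.closure_induction with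
    | mem w hw =>
      rintro f ⟨i, hi, l, hl, hf⟩
      rcases Nat.eq_zero_or_pos (digits w) with h0 | h0
      · obtain ⟨k, hk0, hk⟩ := exists_act_eq_shift h0
        have hkT : k ∈ xExponents T := ⟨w, hFT hw, hk⟩
        refine ⟨i + k, Or.inr ?_, l, hl, fun g => ?_⟩
        · rcases hi with rfl | hi
          · simpa using hkT
          · exact add_mem_xExponents hi hkT
        · rw [Function.comp, hf, hk, add_assoc]
      · have hw1 := hγ w hw h0
        rcases hi with rfl | hi
        · refine ⟨0, Or.inl rfl, w :: l, ?_, fun g => ?_⟩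
          · rintro v (_ | ⟨_, hv⟩)
            · refine ⟨hFT hw, hK w hw, fun g => le_max_of_contraction hm ?_⟩
              have := hw1 g
              nlinarith [Nat.zero_le (m * N)]
            · exact hl v hv
          · rw [Function.comp, hf, List.foldr_cons]
            simp
        · obtain ⟨j, i₀, ⟨p, hpT, hp⟩, hle, rfl⟩ := hN i hi
          have hdp : digits p = 0 := by
            rw [digits, hp]; rfl
          obtain ⟨r, hr⟩ := Nat.exists_eq_add_of_le (hK w hw)
          -- The bounded part `x ^ i₀` is absorbed into the letter `w * p`, which is why the bound
          -- is `m * (γ + N)`; the multiple of `e * m ^ K` passes `w`.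
          refine ⟨j * m ^ r * n ^ digits w * e, ?_, (w * p) :: l, ?_, fun g => ?_⟩
          · rcases Nat.eq_zero_or_pos (j * m ^ r * n ^ digits w) with h | h
            · left; rw [h, zero_mul]
            · right
              obtain ⟨d, hd⟩ := Nat.exists_eq_add_of_lt h
              rw [hd, zero_add]
              exact mul_mem_xExponents (he ⟨_, hi⟩) d
          · rintro v (_ | ⟨_, hv⟩)
            · refine ⟨mul_mem (hFT hw) hpT, ?_, fun g => le_max_of_contraction hm ?_⟩
              · rw [digits_mul, hdp]; exact hK w hw
              · rw [act_mul, hp]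
                have h1 := hw1 (g.1 + i₀, g.2)
                have h2 := Nat.mul_le_mul_left m hle
                simp only [mul_add] at h1 h2 ⊢
                omega
            · exact hl v hv
          · rw [Function.comp, hf, List.foldr_cons, act_mul, hp, ← add_assoc,
              show j * (e * m ^ K) = (j * e * m ^ r) * m ^ digits w by rw [hr, pow_add]; ring,
              act_add_mul_pow]
            simp only [Prod.mk.injEq, and_true, add_right_inj]
            ring
    | mul s t _ _ hs ht =>
      intro f hf
      have := hs _ (ht f hf)
      rwa [← Function.comp_assoc, show act m n s ∘ act m n t = act m n (s * t) from
        funext fun g => (act_mul s t g).symm] at this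
  intro t ht
  exact hcomp t (hT ▸ ht) id ⟨0, Or.inl rfl, [], by simp, by simp⟩

/-- Consecutive letters of a word can be multiplied together in such a way that the word becomes
synchronized. -/
theorem exists_synchronized {K C D : ℕ} {s : BSSemigroup m n} (hsT : s ∈ T) (hsK : digits s ≤ K)
    (hsD : ∀ g, (act m n s g).1 ≤ max C g.1 + D) {l : List (BSSemigroup m n)}
    (hl : ∀ w ∈ l, w ∈ contracting T K C) :
    ∃ u : List (BSSemigroup m n), u ≠ [] ∧
      (∀ t ∈ u, t ∈ T ∧ ∀ g, (act m n t g).1 ≤ max C g.1 + D) ∧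
      (∀ t ∈ u.tail, ∀ g, (act m n t g).1 ≤ max C g.1) ∧
      (∀ v, v <+: u → IsSynchronized digits K K v) ∧
      ∀ g, u.foldr (act m n) g = (s :: l).foldr (act m n) g := by
  induction l using List.reverseRecOn with
  | nil =>
    refine ⟨[s], by simp, by simpa using ⟨hsT, fun a b => hsD (a, b)⟩, by simp, fun v hv => ?_,
      fun g => rfl⟩
    rcases List.prefix_concat_iff (l₂ := []) |>.1 hv with rfl | hv
    · simp only [IsSynchronized, digitCount_append, digitCount_cons, digitCount_nil,
        List.length_append, List.length_cons, List.length_nil]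
      omega
    · rw [List.prefix_nil.1 hv]
      simp [IsSynchronized]
  | append_singleton l w ih =>
    obtain ⟨u, hu0, hu1, hu2, hu3, hu4⟩ := ih fun v hv => hl v (by simp [hv])
    obtain ⟨hwT, hwK, hwC⟩ := hl w (by simp)
    have hu := hu3 u List.prefix_rfl
    -- Greedy rule: if the word lags behind `K` digits per letter, `w` is merged into its last
    -- letter; otherwise `w` becomes a new letter. As `w` has at most `K` digits, the deviation
    -- stays in `[-K, K]`.
    rcases lt_or_ge (digitCount digits u) (u.length * K) with hlt | hge
    · obtain ⟨u', b, rfl⟩ := (List.eq_nil_or_concat u).resolve_left hu0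
      rw [List.concat_eq_append] at *
      have hb := hu1 b (by simp)
      have hmul : ∀ g, (act m n w g).1 ≤ max C g.1 := hwC
      refine ⟨u' ++ [b * w], by simp, ?_, ?_, fun v hv => ?_, fun g => ?_⟩
      · intro t ht
        rcases List.mem_append.1 ht with ht | ht
        · exact hu1 t (by simp [ht])
        · rw [List.mem_singleton.1 ht]
          refine ⟨mul_mem hb.1 hwT, fun g => ?_⟩
          rw [act_mul]
          have h1 := hb.2 (act m n w g)
          have h2 := hmul g
          omega
      · intro t ht g
        by_cases hnil : u' = []
        · subst hnil
          simp at ht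
        · rw [List.tail_append_of_ne_nil hnil] at ht hu2
          rcases List.mem_append.1 ht with ht | ht
          · exact hu2 t (by simp [ht]) g
          · rw [List.mem_singleton.1 ht, act_mul]
            have h1 := hu2 b (by simp) (act m n w g)
            have h2 := hmul g
            omega
      · rcases List.prefix_concat_iff.1 hv with rfl | hv
        · simp only [IsSynchronized, digitCount_append, digitCount_cons, digitCount_nil,
            List.length_append, List.length_cons, List.length_nil, digits_mul] at hu hlt ⊢
          omega
        · exact hu3 v (hv.trans (List.prefix_append _ _))
      · have := hu4 (act m n w g)
        rw [List.foldr_append] at this ⊢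
        rw [← List.cons_append, List.foldr_append]
        simp only [List.foldr_cons, List.foldr_nil, act_mul] at this ⊢
        exact this
    · refine ⟨u ++ [w], by simp, ?_, ?_, fun v hv => ?_, fun g => ?_⟩
      · intro t ht
        rcases List.mem_append.1 ht with ht | ht
        · exact hu1 t ht
        · rw [List.mem_singleton.1 ht]
          exact ⟨hwT, fun g => (hwC g).trans (Nat.le_add_right _ _)⟩
      · intro t ht
        rw [List.tail_append_of_ne_nil hu0] at ht
        rcases List.mem_append.1 ht with ht | ht
        · exact hu2 t ht
        · rw [List.mem_singleton.1 ht]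
          exact hwC
      · rcases List.prefix_concat_iff.1 hv with rfl | hv
        · simp only [IsSynchronized, digitCount_append, digitCount_cons, digitCount_nil,
            List.length_append, List.length_cons, List.length_nil, add_mul] at hu hge ⊢
          omega
        · exact hu3 v hv
      · rw [List.foldr_append, hu4, ← List.cons_append, List.foldr_append]

/-- One letter allows `K` digits, and the deviations before and after it differ by at most `2 * K`.
-/
theorem digits_le_of_isSynchronized {K : ℕ} {u : List (BSSemigroup m n)}
    (hu : ∀ v, v <+: u → IsSynchronized digits K K v) {t : BSSemigroup m n} (ht : t ∈ u) :
    digits t ≤ 3 * K := by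
  obtain ⟨u₁, u₂, rfl⟩ := List.append_of_mem ht
  have h1 := hu u₁ (List.prefix_append _ _)
  have h2 := hu (u₁ ++ [t]) ⟨u₂, by simp⟩
  simp only [IsSynchronized, digitCount_append, digitCount_cons, digitCount_nil,
    List.length_append, List.length_cons, List.length_nil, add_mul] at h1 h2
  omega

/-- The elements of `T` that push at most `K` digits and exceed no bound `≥ C` by more than `D`. -/
abbrev Letter (T : Subsemigroup (BSSemigroup m n)) (K C D : ℕ) : Type :=
  {t : BSSemigroup m n // t ∈ T ∧ digits t ≤ K ∧ ∀ g, (act m n t g).1 ≤ max C g.1 + D}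

/-- A letter is determined by its image of `(0, [])`, whose number and digit list are bounded. -/
instance Letter.finite (T : Subsemigroup (BSSemigroup m n)) (K C D : ℕ) :
    Finite (Letter T K C D) := by
  have hfin : (Set.Iic (C + D) ×ˢ {l : List (Fin m) | l.length ≤ K}).Finite :=
    (Set.finite_Iic _).prod (List.finite_length_le _ _)
  have := hfin.to_subtype
  refine Finite.of_injective (β := ↥(Set.Iic (C + D) ×ˢ {l : List (Fin m) | l.length ≤ K}))
    (fun a => ⟨act m n a.1 (0, []), ?_, a.2.2.1⟩) fun a b hab => ?_
  · have := a.2.2.2 (0, [])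
    simpa using this
  · exact Subtype.ext (act_injective (Subtype.ext_iff.1 hab))

theorem foldr_act_map_val {K C D : ℕ} (u : List (Letter T K C D)) (g : ℕ × List (Fin m)) :
    (u.map Subtype.val).foldr (act m n) g = u.foldr (fun a => act m n a.1) g := by
  rw [List.foldr_map]

theorem digitCount_map_val {K C D : ℕ} (u : List (Letter T K C D)) :
    digitCount digits (u.map Subtype.val) = digitCount (fun a => digits a.1) u := by
  rw [digitCount, digitCount, List.map_map]
  rfl

theorem isRightAutomatic_of_fg (hmn : n < m) {F : Set (BSSemigroup m n)} (hF : F.Finite)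
    (hT : Subsemigroup.closure F = T) : IsRightAutomatic T := by
  obtain ⟨e, he0, he⟩ : ∃ e, 0 < e ∧ ((xExponents T).Nonempty → e ∈ xExponents T) := by
    rcases (xExponents T).eq_empty_or_nonempty with h | ⟨e, he⟩
    · exact ⟨1, one_pos, fun h' => absurd h' (by simp [h])⟩
    · exact ⟨e, pos_of_mem_xExponents he, fun _ => he⟩
  obtain ⟨K, C, N, hK0, hN, hprod⟩ := isShiftedProduct_act hmn hF hT he he0
  -- Room for the letters that are pure shifts: by some `i₀ ≤ N` and by `e`.
  obtain ⟨D, hD⟩ : ∃ D, D = N + e := ⟨_, rfl⟩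
  let φ : Letter T (3 * K) C D → T := fun a => ⟨a.1, a.2.1⟩
  let ρ : T → ℕ × List (Fin m) → ℕ × List (Fin m) := fun t => act m n t
  let Y : Letter T (3 * K) C D → ℕ := fun a => digits a.1
  let G : Set (Letter T (3 * K) C D) := {a | ∀ g, (act m n a.1 g).1 ≤ max C g.1}
  have hact : ∀ a, PushesDigits (Y a) (ρ (φ a)) := fun a => pushesDigits a.1
  have hG : ∀ a ∈ G, ∀ g, (ρ (φ a) g).1 ≤ max C g.1 := fun a ha => ha
  have hAll : ∀ a g, (ρ (φ a) g).1 ≤ max C g.1 + D := fun a => a.2.2.2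
  have hmul : ∀ s t g, ρ (s * t) g = ρ s (ρ t g) := fun s t g => act_mul _ _ g
  have hinj : ∀ s t, ρ s (0, []) = ρ t (0, []) → s = t := fun s t h =>
    Subtype.ext (act_injective h)
  have hS := isRegular_synchronizedWords Y K G
  have hsync : ∀ s ∈ T, digits s ≤ K → (∀ g, (act m n s g).1 ≤ max C g.1 + D) →
      ∀ l : List (BSSemigroup m n), (∀ w ∈ l, w ∈ contracting T K C) →
      ∃ u ∈ synchronizedWords Y K G,
        ∀ g, (s :: l).foldr (act m n) g = u.foldr (fun a => ρ (φ a)) g := by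
    intro s hsT hsK hsD l hl
    obtain ⟨u, hu0, hu1, hu2, hu3, hu4⟩ := exists_synchronized hsT hsK hsD hl
    have hu5 : ∀ t ∈ u, t ∈ T ∧ digits t ≤ 3 * K ∧ ∀ g, (act m n t g).1 ≤ max C g.1 + D :=
      fun t ht => ⟨(hu1 t ht).1, digits_le_of_isSynchronized hu3 ht, (hu1 t ht).2⟩
    lift u to List (Letter T (3 * K) C D) using hu5
    refine ⟨u, ⟨fun h => hu0 (by rw [h]; rfl), fun v hv => ?_, fun a ha => ?_⟩, fun g => ?_⟩
    · have := hu3 _ (hv.map Subtype.val)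
      rwa [IsSynchronized, digitCount_map_val, List.length_map] at this
    · exact hu2 a.1 (by rw [← List.map_tail]; exact List.mem_map_of_mem ha)
    · rw [← hu4, foldr_act_map_val]
  rcases (xExponents T).eq_empty_or_nonempty with hP | hP
  · refine isRightAutomatic_of_coincidenceLanguage ρ hmul hinj φ (synchronizedWords Y K G) hS
      (fun u hu => hu.1) (fun t => ?_) fun g h => ?_
    · obtain ⟨i, hi, l, hl, ht⟩ := hprod t.1 t.2
      obtain rfl : i = 0 := hi.resolve_right (by simp [hP])
      cases l with
      | nil =>
        -- The empty product without shift would fix `(0, [])`, which no element does.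
        have := fst_add_length_pos t.1 (0, [])
        rw [ht] at this
        simp at this
      | cons w l =>
        obtain ⟨hwT, hwK, hwC⟩ := hl w (by simp)
        obtain ⟨u, hu, hval⟩ := hsync w hwT hwK
          (fun g => (hwC g).trans (Nat.le_add_right _ _)) l fun v hv => hl v (by simp [hv])
        refine ⟨u, hu, fun g => ?_⟩
        rw [← hval]
        exact ht g
    · exact isRegular_coincidenceLanguage he0 hact hG hAll hS
        (fun u hu => ⟨[], u, rfl, hu, by simp⟩) g h
  · obtain ⟨p, hpT, hp⟩ := he hP
    have hpd : digits p = 0 := by rw [digits, hp]; rfl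
    let a : Letter T (3 * K) C D := ⟨p, hpT, by omega, fun g => by rw [hp]; simp only; omega⟩
    have ha : ∀ g, ρ (φ a) g = (g.1 + e, g.2) := hp
    have harep : ∀ j, ∀ b ∈ List.replicate j a, ∀ g, ρ (φ b) g = (g.1 + e, g.2) :=
      fun j b hb => by rw [List.eq_of_mem_replicate hb]; exact ha
    have hL := hS.prependPowers a
    refine isRightAutomatic_of_coincidenceLanguage ρ hmul hinj φ
      ((synchronizedWords Y K G).prependPowers a) hL ?_ (fun t => ?_) fun g h => ?_
    · rintro _ ⟨j, v, hv, rfl⟩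
      exact List.append_ne_nil_of_right_ne_nil _ hv.1
    · obtain ⟨i, hi, l, hl, ht⟩ := hprod t.1 t.2
      rcases hi with rfl | hi
      · cases l with
        | nil =>
          have := fst_add_length_pos t.1 (0, [])
          rw [ht] at this
          simp at this
        | cons w l =>
          obtain ⟨hwT, hwK, hwC⟩ := hl w (by simp)
          obtain ⟨u, hu, hval⟩ := hsync w hwT hwK
            (fun g => (hwC g).trans (Nat.le_add_right _ _)) l fun v hv => hl v (by simp [hv])
          refine ⟨u, ⟨0, u, hu, by simp⟩, fun g => ?_⟩
          rw [← hval]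
          exact ht g
      -- The shift splits into `a ^ j` and a first letter `x ^ i₀`, the one letter allowed outside
      -- `G`.
      · obtain ⟨j, i₀, ⟨s, hsT, hs⟩, hle, rfl⟩ := hN i hi
        have hsd : digits s = 0 := by rw [digits, hs]; rfl
        obtain ⟨u, hu, hval⟩ := hsync s hsT (by omega)
          (fun g => by rw [hs]; simp only; omega) l hl
        refine ⟨List.replicate j a ++ u, ⟨j, u, hu, rfl⟩, fun g => ?_⟩
        rw [List.foldr_append, ← hval, foldr_shift (harep j), List.foldr_cons, hs,
          List.length_replicate, add_assoc]
        exact ht g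
    · rw [coincidenceLanguage_prependPowers (act := fun a => ρ (φ a)) ha]
      refine Language.IsRegular.prependPowers (isRegular_coincidenceLanguage he0 hact hG hAll hL
        ?_ g h) _
      rintro _ ⟨j, v, hv, rfl⟩
      exact ⟨_, v, rfl, hv, harep j⟩

end BSSemigroup

theorem theorem1 (m n : ℕ) (hn : 0 < n) (hmn : n < m) (T : Subsemigroup (BSSemigroup m n))
    (hT : ∃ F : Set (BSSemigroup m n), F.Finite ∧ Subsemigroup.closure F = T) :
    IsRightAutomatic T := by
  obtain ⟨F, hF, hFT⟩ := hT
  have : NeZero m := ⟨by omega⟩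
  exact BSSemigroup.isRightAutomatic_of_fg hmn hF hFT
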